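/- Let $V$ be an oriented $3$-dimensional real vector space with a Lorentzian metric $g_{ab}$ of signature $(+,-,-)$ (for instance a tangent space of an oriented Lorentzian $3$-manifold), with canonical volume form $\eta_{abc}$; indices are raised and lowered with $g$. A rank-2 tensor $T_{ab}$ defines the linear map $k^a\mapsto k^aT_a{}^b$. A Lorentz transformation is a linear map $L$ of $V$ preserving $g$, and it is involutory if $L=L^{-1}$. For a 1-form $\Sigma=\Sigma_{[1]}$ write $\Sigma\cdot\Sigma=\Sigma_a\Sigma^a$, let $(*\Sigma)_{ab}=\eta_{abc}\Sigma^c$ be its Hodge dual, and let $$T_{ab}\{\Sigma_{[1]}\}=\tfrac12\left(\Sigma_a\Sigma_b-(*\Sigma)_{ac}(*\Sigma)_b{}^{c}\right)=\Sigma_a\Sigma_b-\tfrac12(\Sigma\cdot\Sigma)\,g_{ab}$$ be its superenergy tensor. (i) A tensor $T_{ab}$ on $V$ defines a map of the form $cL$, with $c\in\mathbb R\setminus\{0\}$ and $L$ a non-involutory Lorentz transformation, if and only if $$T_{ab}=\beta\, T_{ab}\{\Sigma_{[1]}\}+\alpha\, g_{ab}+\varepsilon\sqrt{2\alpha\beta}\,(*\Sigma)_{ab}$$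 for some $\alpha,\beta\in\mathbb R$ with $\alpha\beta>0$, some sign $\varepsilon\in\{1,-1\}$, and some 1-form $\Sigma\neq0$ with $2\alpha+\beta\,(\Sigma\cdot\Sigma)\neq0$. (ii) For every tensor of the displayed form with $\alpha\beta>0$, $\varepsilon\in\{1,-1\}$ and $\Sigma\ne0$, the map $T_a{}^b$ is non-singular if and only if $2\alpha+\beta\,(\Sigma\cdot\Sigma)\ne0$. In that case, the number of null directions (lines spanned by a non-zero null vector) left invariant by the map is exactly $0$ if $\Sigma$ is timelike ($\Sigma\cdot\Sigma>0$), exactly $1$ if $\Sigma$ is null ($\Sigma\cdot\Sigma=0$), and exactly $2$ if $\Sigma$ is spacelike ($\Sigma\cdot\Sigma<0$). -/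

import Mathlib

/-- A Lorentzian metric `g_ab` of signature `(+,-,…,-)` on an `N`-dimensional real vector space:
a bilinear form that is diagonal with entries `1, -1, …, -1` in some basis. -/
structure LorentzMetric (N : ℕ) [NeZero N] (V : Type*) [AddCommGroup V] [Module ℝ V] where
  /-- The inner product `g_ab x^a y^b`. -/
  form : LinearMap.BilinForm ℝ V
  exists_basis : ∃ e : Module.Basis (Fin N) ℝ V, ∀ i j : Fin N,
    form (e i) (e j) = if i = j then (if i = 0 then 1 else -1) else 0

namespace LorentzMetric

section General

variable {N : ℕ} [NeZero N] {V : Type*} [AddCommGroup V] [Module ℝ V]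

theorem finiteDimensional (g : LorentzMetric N V) : FiniteDimensional ℝ V := by
  obtain ⟨e, -⟩ := g.exists_basis
  exact e.finiteDimensional_of_finite

theorem card_eq_finrank (g : LorentzMetric N V) :
    Fintype.card (Fin N) = Module.finrank ℝ V := by
  obtain ⟨e, -⟩ := g.exists_basis
  exact (Module.finrank_eq_card_basis e).symm

theorem nondegenerate (g : LorentzMetric N V) : g.form.Nondegenerate := by
  obtain ⟨e, he⟩ := g.exists_basis
  have hd : ∀ i, (if i = (0 : Fin N) then (1 : ℝ) else -1) ≠ 0 := by
    intro i; split_ifs <;> norm_num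
  constructor
  · intro x hx
    refine e.ext_elem fun j => ?_
    have h := hx (e j)
    rw [← e.sum_repr x] at h
    simp only [map_sum, map_smul, LinearMap.sum_apply, LinearMap.smul_apply, he, smul_eq_mul,
      mul_ite, mul_zero, Finset.sum_ite_eq', Finset.mem_univ, if_true] at h
    have h' : e.repr x j * (if j = (0 : Fin N) then (1 : ℝ) else -1) = 0 := by
      simpa using h
    simpa using (mul_eq_zero.mp h').resolve_right (hd j)
  · intro x hx
    refine e.ext_elem fun j => ?_
    have h := hx (e j)
    rw [← e.sum_repr x] at h
    simp only [map_sum, map_smul, he, smul_eq_mul,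
      mul_ite, mul_zero, Finset.sum_ite_eq, Finset.mem_univ, if_true] at h
    have h' : e.repr x j * (if j = (0 : Fin N) then (1 : ℝ) else -1) = 0 := by
      simpa using h
    simpa using (mul_eq_zero.mp h').resolve_right (hd j)

/-- Raising an index: `ω_a ↦ ω^a`, the vector with `g_ab ω^a x^b = ω_b x^b` for all `x`. -/
noncomputable def sharp (g : LorentzMetric N V) : Module.Dual ℝ V ≃ₗ[ℝ] V :=
  haveI := g.finiteDimensional
  (g.form.toDual g.nondegenerate).symm

/-- The inner product `ω · θ = g^ab ω_a θ_b` of two 1-forms. -/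
noncomputable def coInner (g : LorentzMetric N V) (ω θ : Module.Dual ℝ V) : ℝ :=
  g.form (g.sharp ω) (g.sharp θ)

/-- The linear map `T_a{}^b : k^a ↦ k^a T_a{}^b` defined by a rank-2 tensor `T_ab`. -/
noncomputable def toMap (g : LorentzMetric N V) (T : LinearMap.BilinForm ℝ V) : V →ₗ[ℝ] V :=
  g.sharp.toLinearMap ∘ₗ T

/-- The product `(T ₂×₂ T)_ab = T_ac T_b{}^c`. -/
noncomputable def sq22 (g : LorentzMetric N V) (T : LinearMap.BilinForm ℝ V) :
    LinearMap.BilinForm ℝ V :=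
  g.form.compl₁₂ (g.toMap T) (g.toMap T)

/-- The canonical volume form `η` of an oriented Lorentzian vector space,
`√|det g_ij| e¹ ∧ … ∧ e^N` in any positively oriented basis. -/
noncomputable def volumeForm (g : LorentzMetric N V) (o : Orientation ℝ V (Fin N)) :
    V [⋀^Fin N]→ₗ[ℝ] ℝ :=
  haveI := g.finiteDimensional
  let b := o.someBasis g.card_eq_finrank
  √|(LinearMap.BilinForm.toMatrix b g.form).det| • b.det

/-- `L` is a Lorentz transformation: a linear isometry of `g`. -/
def IsLorentz (g : LorentzMetric N V) (L : V →ₗ[ℝ] V) : Prop :=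
  ∀ x y : V, g.form (L x) (L y) = g.form x y

/-- The map defined by `T_ab` is a non-zero multiple of a Lorentz transformation `L` which is not
involutory (that is, `L ≠ L⁻¹`, or `L ∘ L ≠ id`). -/
def IsPropNonInvolutoryLorentz (g : LorentzMetric N V) (T : LinearMap.BilinForm ℝ V) : Prop :=
  ∃ (c : ℝ) (L : V →ₗ[ℝ] V), c ≠ 0 ∧ g.IsLorentz L ∧ L ∘ₗ L ≠ LinearMap.id ∧ g.toMap T = c • L

/-- The null directions (lines spanned by a non-zero null vector) that are left invariant by the
map `f`. -/
def invariantNullDirections (g : LorentzMetric N V) (f : V →ₗ[ℝ] V) : Set (Submodule ℝ V) :=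
  {ℓ | (∃ k : V, k ≠ 0 ∧ g.form k k = 0 ∧ ℓ = Submodule.span ℝ {k}) ∧ ℓ.map f = ℓ}

end General

section Three

variable {V : Type*} [AddCommGroup V] [Module ℝ V]

/-- The Hodge dual of a 1-form in three dimensions, `(*ω)_ab = η_abc ω^c`. -/
noncomputable def hodgeDual (g : LorentzMetric 3 V) (o : Orientation ℝ V (Fin 3))
    (ω : Module.Dual ℝ V) : LinearMap.BilinForm ℝ V :=
  LinearMap.mk₂ ℝ (fun x y => g.volumeForm o ![x, y, g.sharp ω])
    (fun x x' y => (g.volumeForm o).map_vecCons_add ![y, g.sharp ω] x x')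
    (fun c x y => (g.volumeForm o).map_vecCons_smul ![y, g.sharp ω] c x)
    (fun x y y' => by
      simpa using ((g.volumeForm o).curryLeft x).map_vecCons_add ![g.sharp ω] y y')
    (fun c x y => by
      simpa using ((g.volumeForm o).curryLeft x).map_vecCons_smul ![g.sharp ω] c y)

/-- The superenergy tensor `T{ω} = ½ (ω ⊙ ω + *ω ⊙ *ω)` of a 1-form in three dimensions. Here
`(A ⊙ A)_ab = (-1)^(p-1)/(p-1)! A_{a c₂…c_p} A_b{}^{c₂…c_p}` for a `p`-form `A`, so that
`(ω ⊙ ω)_ab = ω_a ω_b` and `(*ω ⊙ *ω)_ab = - (*ω)_ac (*ω)_b{}^c`. -/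
noncomputable def superenergy (g : LorentzMetric 3 V) (o : Orientation ℝ V (Fin 3))
    (ω : Module.Dual ℝ V) : LinearMap.BilinForm ℝ V :=
  (1 / 2 : ℝ) • (LinearMap.BilinForm.linMulLin ω ω + -g.sq22 (g.hodgeDual o ω))

end Three

end LorentzMetric

/-!
In dimension three the map `J` defined by `*Σ` is the Lorentzian cross product with `Σ`. It is
skew-adjoint and `J² = Σ ⊗ Σ^♯ - Σ·Σ`, whence `J³ = -(Σ·Σ) J` and `tr J² = -2 Σ·Σ`. The tensor
`β T{Σ} + α g + γ *Σ` acts as `F = (α + ½ β Σ·Σ) + γ J + β J²`, and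
`F† F = (α + ½ β Σ·Σ)² + (2αβ - γ²) J²`, so `F` is conformal when `γ² = 2αβ`. Conversely, if `L` is
a proper Lorentz transformation, `J = ½ (L - L⁻¹)` is skew-adjoint, hence a cross product, and the
Cayley–Hamilton theorem gives `J² = ¼ (tr L + 1) (L + L⁻¹ - 2)`, so that `L` is such a polynomial
in `J`.

Two orthogonal null vectors are proportional, so an injective map `F` preserving null vectors
leaves the null line of `k` invariant exactly when `F k` is orthogonal to `k`. Here
`g(F k, k) = β Σ(k)²`: the invariant null directions are the null lines in the plane orthogonal
to `Σ`. When `Σ·Σ = -r² < 0` they are the eigenlines of `J` for `r` and `-r`.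
-/

section Algebra

open LinearMap (trace det IsAdjointPair)

theorem adjugate_fin_three_eq_mul_self_sub_trace_smul {R : Type*} [CommRing R]
    (M : Matrix (Fin 3) (Fin 3) R) :
    M.adjugate = M * M - M.trace • M + M.adjugate.trace • 1 := by
  ext i j
  rw [Matrix.adjugate_fin_three]
  fin_cases i <;> fin_cases j <;>
    simp [Matrix.mul_apply, Matrix.trace_fin_three, Fin.sum_univ_three] <;> ring

/-- The Cayley–Hamilton theorem multiplied by `L⁻¹ = K`. -/
theorem mul_self_sub_trace_smul_add_of_mul_eq_one {R M : Type*} [CommRing R] [AddCommGroup M]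
    [Module R M] (b : Module.Basis (Fin 3) R M) {L K : Module.End R M} (hLK : L * K = 1) :
    L * L - trace R M L • L + (det L * trace R M K) • 1 = det L • K := by
  have hinv : LinearMap.toMatrix b b L * LinearMap.toMatrix b b K = 1 := by
    rw [← LinearMap.toMatrix_mul, hLK, LinearMap.toMatrix_one]
  have hadj : (LinearMap.toMatrix b b L).adjugate = det L • LinearMap.toMatrix b b K := by
    rw [← LinearMap.det_toMatrix b, ← one_mul (LinearMap.toMatrix b b K), ← smul_mul_assoc,
      ← Matrix.adjugate_mul, mul_assoc, hinv, mul_one]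
  apply (LinearMap.toMatrix b b).injective
  have h := adjugate_fin_three_eq_mul_self_sub_trace_smul (LinearMap.toMatrix b b L)
  rw [hadj, Matrix.trace_smul, smul_eq_mul, ← LinearMap.trace_eq_matrix_trace,
    ← LinearMap.trace_eq_matrix_trace] at h
  simpa only [map_add, map_sub, map_smul, LinearMap.toMatrix_mul, LinearMap.toMatrix_one]
    using h.symm

variable {𝕜 V : Type*} [Field 𝕜] [AddCommGroup V] [Module 𝕜 V] [FiniteDimensional 𝕜 V]
  {B : LinearMap.BilinForm 𝕜 V} {L K : Module.End 𝕜 V}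

theorem dualMap_eq_conj_toDual_of_isAdjointPair (hB : B.Nondegenerate)
    (h : IsAdjointPair B B L K) : K.dualMap = (B.toDual hB).conj L := by
  refine LinearMap.ext fun φ => LinearMap.ext fun y => ?_
  rw [LinearEquiv.conj_apply_apply, LinearMap.BilinForm.toDual_def, h,
    LinearMap.BilinForm.apply_toDual_symm_apply, LinearMap.dualMap_apply]

theorem trace_eq_trace_of_isAdjointPair (hB : B.Nondegenerate) (h : IsAdjointPair B B L K) :
    trace 𝕜 V K = trace 𝕜 V L := by
  rw [← LinearMap.trace_transpose', ← LinearMap.dualMap_def,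
    dualMap_eq_conj_toDual_of_isAdjointPair hB h, LinearMap.trace_conj']

theorem det_eq_det_of_isAdjointPair (hB : B.Nondegenerate) (h : IsAdjointPair B B L K) :
    det K = det L := by
  rw [← LinearMap.det_dualMap, dualMap_eq_conj_toDual_of_isAdjointPair hB h]
  exact LinearMap.det_conj L (B.toDual hB)

end Algebra

theorem ne_zero_and_sq_eq_iff_exists_sign_mul_sqrt {x y : ℝ} :
    (x ≠ 0 ∧ x ^ 2 = y) ↔ 0 < y ∧ ∃ ε : ℝ, (ε = 1 ∨ ε = -1) ∧ x = ε * √y := by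
  constructor
  · rintro ⟨hx, rfl⟩
    refine ⟨by positivity, SignType.sign x, ?_, ?_⟩
    · rcases lt_or_gt_of_ne hx with h | h <;> simp [h]
    · rw [Real.sqrt_sq_eq_abs, sign_mul_abs]
  · rintro ⟨hy, ε, rfl | rfl, rfl⟩ <;> simp [hy.le, (Real.sqrt_pos.2 hy).ne']

namespace LorentzMetric

section General

open LinearMap (trace det IsAdjointPair)

variable {N : ℕ} [NeZero N] {V : Type*} [AddCommGroup V] [Module ℝ V] (g : LorentzMetric N V)

/-- The basis `e` is orthonormal for `g`, with `e 0` timelike and the other vectors spacelike. -/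
def IsOrthonormal (e : Module.Basis (Fin N) ℝ V) : Prop :=
  ∀ i j, g.form (e i) (e j) = if i = j then (if i = 0 then 1 else -1) else 0

theorem exists_isOrthonormal : ∃ e : Module.Basis (Fin N) ℝ V, g.IsOrthonormal e :=
  g.exists_basis

section Orthonormal

variable {g} {e : Module.Basis (Fin N) ℝ V} (he : g.IsOrthonormal e)

include he

theorem IsOrthonormal.form_basis_left (i : Fin N) (x : V) :
    g.form (e i) x = (if i = 0 then 1 else -1) * e.repr x i := by
  conv_lhs => rw [← e.sum_repr x]
  simp [-Module.Basis.sum_repr, he i, mul_comm]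

theorem IsOrthonormal.form_eq_sum (x y : V) :
    g.form x y = ∑ i, (if i = 0 then 1 else -1) * (e.repr x i * e.repr y i) := by
  conv_lhs => rw [← e.sum_repr x]
  simp only [map_sum, map_smul, LinearMap.sum_apply, LinearMap.smul_apply, he.form_basis_left,
    smul_eq_mul, mul_left_comm]

theorem IsOrthonormal.volumeForm_sq (o : Orientation ℝ V (Fin N)) :
    g.volumeForm o e ^ 2 = 1 := by
  have := g.finiteDimensional
  let b := o.someBasis g.card_eq_finrank
  have hdet : |(LinearMap.BilinForm.toMatrix e g.form).det| = 1 := by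
    have hdiag : LinearMap.BilinForm.toMatrix e g.form =
        Matrix.diagonal fun i => if i = 0 then 1 else -1 := by
      ext i j
      rw [LinearMap.BilinForm.toMatrix_apply, he, Matrix.diagonal_apply]
    rw [hdiag, Matrix.det_diagonal, Finset.abs_prod]
    exact Finset.prod_eq_one fun i _ => by split_ifs <;> simp
  have hvol : g.volumeForm o e = √|(LinearMap.BilinForm.toMatrix b g.form).det| * b.det e := rfl
  rw [hvol, mul_pow, Real.sq_sqrt (abs_nonneg _), ← sq_abs, ← hdet,
    ← LinearMap.BilinForm.toMatrix_mul_basis_toMatrix (b := b) e g.form, Matrix.det_mul,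
    Matrix.det_mul, Matrix.det_transpose, abs_mul, abs_mul, ← Module.Basis.det_apply]
  ring

theorem IsOrthonormal.eq_zero_of_form_eq_zero {x : V} (hx0 : g.form (e 0) x = 0)
    (hx : 0 ≤ g.form x x) : x = 0 := by
  have hrepr : e.repr x 0 = 0 := by simpa using (he.form_basis_left 0 x).symm.trans hx0
  have hform : g.form x x = -∑ i, e.repr x i ^ 2 := by
    rw [he.form_eq_sum, ← Finset.sum_neg_distrib]
    refine Finset.sum_congr rfl fun i _ => ?_
    by_cases hi : i = 0
    · simp [hi, hrepr]
    · simp [hi, sq]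
  have hsum : ∑ i, e.repr x i ^ 2 = 0 :=
    le_antisymm (by linarith) (Finset.sum_nonneg fun i _ => sq_nonneg _)
  rw [Finset.sum_eq_zero_iff_of_nonneg fun i _ => sq_nonneg _] at hsum
  exact e.ext_elem fun i => by simpa using hsum i (Finset.mem_univ i)

end Orthonormal

theorem form_comm (x y : V) : g.form x y = g.form y x := by
  obtain ⟨e, he⟩ := g.exists_isOrthonormal
  simp only [he.form_eq_sum, mul_comm (e.repr x _)]

theorem ext_form {x y : V} (h : ∀ z, g.form x z = g.form y z) : x = y :=
  sub_eq_zero.1 <| g.nondegenerate.1 _ fun z => by simp [h z]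

theorem form_sharp (ω : Module.Dual ℝ V) (y : V) : g.form (g.sharp ω) y = ω y :=
  have := g.finiteDimensional
  LinearMap.BilinForm.apply_toDual_symm_apply (hB := g.nondegenerate) ω y

theorem form_toMap (T : LinearMap.BilinForm ℝ V) (x y : V) : g.form (g.toMap T x) y = T x y :=
  g.form_sharp (T x) y

theorem toMap_injective : Function.Injective g.toMap := fun T T' h =>
  LinearMap.ext₂ fun x y => by rw [← g.form_toMap T, ← g.form_toMap T', h]

theorem toMap_smul (c : ℝ) (T : LinearMap.BilinForm ℝ V) : g.toMap (c • T) = c • g.toMap T :=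
  LinearMap.comp_smul _ _ _

theorem apply_sharp (ω : Module.Dual ℝ V) : ω (g.sharp ω) = g.coInner ω ω :=
  (g.form_sharp ω _).symm

theorem sharp_ne_zero {ω : Module.Dual ℝ V} (hω : ω ≠ 0) : g.sharp ω ≠ 0 :=
  g.sharp.map_ne_zero_iff.2 hω

include g in
theorem trace_one : trace ℝ V 1 = N := by
  have := g.finiteDimensional
  rw [LinearMap.trace_one, ← g.card_eq_finrank, Fintype.card_fin]

section Null

variable {g} {k w : V}

theorem mem_span_singleton_of_orthogonal_null (hk : k ≠ 0) (hkk : g.form k k = 0)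
    (hkw : g.form k w = 0) (hww : 0 ≤ g.form w w) : w ∈ Submodule.span ℝ {k} := by
  obtain ⟨e, he⟩ := g.exists_isOrthonormal
  have hek : g.form (e 0) k ≠ 0 := fun h => hk (he.eq_zero_of_form_eq_zero h hkk.ge)
  refine Submodule.mem_span_singleton.2 ⟨g.form (e 0) w / g.form (e 0) k, ?_⟩
  refine (sub_eq_zero.1 (he.eq_zero_of_form_eq_zero ?_ ?_)).symm
  · simp [hek]
  · simpa [hkk, hkw, g.form_comm w k] using hww

theorem span_singleton_eq_of_orthogonal_null (hk : k ≠ 0) (hw : w ≠ 0) (hkk : g.form k k = 0)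
    (hww : g.form w w = 0) (hkw : g.form k w = 0) :
    Submodule.span ℝ {w} = Submodule.span ℝ {k} := by
  obtain ⟨m, rfl⟩ := Submodule.mem_span_singleton.1
    (mem_span_singleton_of_orthogonal_null hk hkk hkw hww.ge)
  exact Submodule.span_singleton_smul_eq (left_ne_zero_of_smul hw).isUnit k

theorem span_singleton_mem_invariantNullDirections_iff {f : Module.End ℝ V}
    (hf : Function.Injective f) (hnull : ∀ x, g.form x x = 0 → g.form (f x) (f x) = 0)
    (hk : k ≠ 0) (hkk : g.form k k = 0) :
    Submodule.span ℝ {k} ∈ g.invariantNullDirections f ↔ g.form k (f k) = 0 := by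
  rw [invariantNullDirections, Set.mem_ofPred_eq, LinearMap.map_span, Set.image_singleton]
  constructor
  · rintro ⟨-, hspan⟩
    obtain ⟨m, hm⟩ := Submodule.mem_span_singleton.1
      (hspan ▸ Submodule.mem_span_singleton_self (f k))
    rw [← hm, map_smul, hkk, smul_zero]
  · exact fun h => ⟨⟨k, hk, hkk, rfl⟩, span_singleton_eq_of_orthogonal_null hk
      ((map_ne_zero_iff f hf).2 hk) hkk (hnull k hkk) h⟩

variable (g) in
/-- The null directions contained in the subspace `W`; for `W` the kernel of a 1-form, these are
the null lines orthogonal to that form. -/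
def nullDirections (W : Submodule ℝ V) : Set (Submodule ℝ V) :=
  {ℓ | ∃ k ∈ W, k ≠ 0 ∧ g.form k k = 0 ∧ ℓ = Submodule.span ℝ {k}}

theorem invariantNullDirections_eq_nullDirections {f : Module.End ℝ V} {W : Submodule ℝ V}
    (hf : Function.Injective f) (hnull : ∀ x, g.form x x = 0 → g.form (f x) (f x) = 0)
    (hW : ∀ x, g.form x x = 0 → (g.form x (f x) = 0 ↔ x ∈ W)) :
    g.invariantNullDirections f = g.nullDirections W := by
  ext ℓ
  constructor
  · intro hℓ
    obtain ⟨⟨k, hk, hkk, rfl⟩, -⟩ := id hℓ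
    rw [span_singleton_mem_invariantNullDirections_iff hf hnull hk hkk, hW k hkk] at hℓ
    exact ⟨k, hℓ, hk, hkk, rfl⟩
  · rintro ⟨k, hkW, hk, hkk, rfl⟩
    rwa [span_singleton_mem_invariantNullDirections_iff hf hnull hk hkk, hW k hkk]

variable {ω : Module.Dual ℝ V}

theorem nullDirections_ker_eq_empty (hω : 0 < g.coInner ω ω) :
    g.nullDirections (LinearMap.ker ω) = ∅ := by
  refine Set.eq_empty_of_forall_notMem ?_
  rintro - ⟨k, hωk, hk, hkk, rfl⟩
  have hmem : g.sharp ω ∈ Submodule.span ℝ {k} :=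
    mem_span_singleton_of_orthogonal_null hk hkk (by rwa [g.form_comm, form_sharp]) hω.le
  obtain ⟨m, hm⟩ := Submodule.mem_span_singleton.1 hmem
  simp [coInner, ← hm, hkk] at hω

theorem nullDirections_ker_eq_singleton (hω : ω ≠ 0) (hnull : g.coInner ω ω = 0) :
    g.nullDirections (LinearMap.ker ω) = {Submodule.span ℝ {g.sharp ω}} := by
  refine Set.Subset.antisymm ?_ (Set.singleton_subset_iff.2 ?_)
  · rintro - ⟨k, hωk, hk, hkk, rfl⟩
    exact span_singleton_eq_of_orthogonal_null (g.sharp_ne_zero hω) hk hnull hkk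
      (by rwa [form_sharp])
  · exact ⟨g.sharp ω, by rwa [LinearMap.mem_ker, apply_sharp], g.sharp_ne_zero hω, hnull, rfl⟩

end Null

section Lorentz

variable {g} {L K : Module.End ℝ V}

theorem IsLorentz.isUnit (hL : g.IsLorentz L) : IsUnit L := by
  have := g.finiteDimensional
  rw [LinearMap.isUnit_iff_ker_eq_bot, LinearMap.ker_eq_bot']
  exact fun x hx => g.nondegenerate.1 x fun y => by simp [← hL x y, hx]

theorem IsLorentz.isAdjointPair (hL : g.IsLorentz L) (hLK : L * K = 1) :
    IsAdjointPair g.form g.form L K := fun x y => by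
  rw [← hL x (K y), ← Module.End.mul_apply, hLK, Module.End.one_apply]

theorem IsLorentz.of_mul_eq_one (hL : g.IsLorentz L) (hLK : L * K = 1) : g.IsLorentz K :=
  fun x y => by
    rw [← hL (K x), ← Module.End.mul_apply, ← Module.End.mul_apply, hLK, Module.End.one_apply,
      Module.End.one_apply]

theorem IsLorentz.trace_eq_of_mul_eq_one (hL : g.IsLorentz L) (hLK : L * K = 1) :
    trace ℝ V K = trace ℝ V L :=
  have := g.finiteDimensional
  trace_eq_trace_of_isAdjointPair g.nondegenerate (hL.isAdjointPair hLK)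

theorem IsLorentz.det_sq (hL : g.IsLorentz L) : det L ^ 2 = 1 := by
  have := g.finiteDimensional
  obtain ⟨K, hLK⟩ := hL.isUnit.exists_right_inv
  have hdet := det_eq_det_of_isAdjointPair g.nondegenerate (hL.isAdjointPair hLK)
  rw [sq]
  nth_rewrite 2 [← hdet]
  rw [← map_mul, hLK, map_one]

/-- In odd dimension `L` and `-L` have opposite determinants. -/
theorem IsPropNonInvolutoryLorentz.exists_det_eq_one (hN : Odd N) {T : LinearMap.BilinForm ℝ V}
    (hT : g.IsPropNonInvolutoryLorentz T) :
    ∃ (c : ℝ) (L : Module.End ℝ V),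
      c ≠ 0 ∧ g.IsLorentz L ∧ L * L ≠ 1 ∧ det L = 1 ∧ g.toMap T = c • L := by
  obtain ⟨c, L, hc, hL, hLL, hTL⟩ := hT
  have hd : det L * det L = 1 := by rw [← sq, hL.det_sq]
  refine ⟨c * det L, det L • L, mul_ne_zero hc (left_ne_zero_of_mul_eq_one hd), fun x y => ?_,
    ?_, ?_, ?_⟩
  · simp only [LinearMap.smul_apply, map_smul, smul_smul, hd, one_smul, hL x y]
  · rwa [smul_mul_smul_comm, hd, one_smul]
  · obtain ⟨n, rfl⟩ := hN
    rw [LinearMap.det_smul, ← g.card_eq_finrank, Fintype.card_fin, ← pow_succ,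
      show 2 * n + 1 + 1 = 2 * (n + 1) by ring, pow_mul, hL.det_sq, one_pow]
  · rw [hTL, smul_smul, mul_assoc, hd, mul_one]

end Lorentz

end General

end LorentzMetric

namespace LorentzMetric

section Three

open LinearMap (trace det IsAdjointPair)

variable {V : Type*} [AddCommGroup V] [Module ℝ V] (g : LorentzMetric 3 V)
  (o : Orientation ℝ V (Fin 3))

theorem volumeForm_apply_eq_mul (e : Module.Basis (Fin 3) ℝ V) (x y z : V) :
    g.volumeForm o ![x, y, z] = g.volumeForm o e *
      (e.repr x 0 * (e.repr y 1 * e.repr z 2 - e.repr y 2 * e.repr z 1) -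
        e.repr x 1 * (e.repr y 0 * e.repr z 2 - e.repr y 2 * e.repr z 0) +
        e.repr x 2 * (e.repr y 0 * e.repr z 1 - e.repr y 1 * e.repr z 0)) := by
  conv_lhs => rw [(g.volumeForm o).eq_smul_basis_det e]
  simp only [AlternatingMap.smul_apply, smul_eq_mul, Module.Basis.det_apply, Matrix.det_fin_three,
    Module.Basis.toMatrix_apply, Matrix.cons_val]
  ring

section Hodge

variable (S : Module.Dual ℝ V)

theorem hodgeDual_isAlt : (g.hodgeDual o S).IsAlt := fun x =>
  (g.volumeForm o).map_eq_zero_of_eq ![x, x, g.sharp S] (i := 0) (j := 1) rfl (by decide)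

theorem hodgeDual_apply_sharp (x : V) : g.hodgeDual o S x (g.sharp S) = 0 :=
  (g.volumeForm o).map_eq_zero_of_eq ![x, g.sharp S, g.sharp S] (i := 1) (j := 2) rfl (by decide)

theorem exists_hodgeDual_eq {B : LinearMap.BilinForm ℝ V} (hB : B.IsAlt) :
    ∃ S, g.hodgeDual o S = B := by
  obtain ⟨e, he⟩ := g.exists_isOrthonormal
  have hδ : g.volumeForm o e * g.volumeForm o e = 1 := by rw [← sq, he.volumeForm_sq]
  have hvol := g.volumeForm_apply_eq_mul o e
  generalize g.volumeForm o e = δ at hδ hvol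
  let s := δ • (B (e 1) (e 2) • e 0 + B (e 2) (e 0) • e 1 + B (e 0) (e 1) • e 2)
  refine ⟨g.sharp.symm s, e.ext fun i => e.ext fun j => ?_⟩
  have happly : g.hodgeDual o (g.sharp.symm s) (e i) (e j) = g.volumeForm o ![e i, e j, s] := by
    conv_rhs => rw [← g.sharp.apply_symm_apply s]
    rfl
  rw [happly, hvol]
  fin_cases i <;> fin_cases j <;>
    simp [s, hB.self_eq_zero, ← mul_assoc, hδ, hB.neg_eq]

/-- The map `k^a ↦ k^a (*ω)_a{}^b`, the Lorentzian cross product with `ω`. -/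
noncomputable def hodgeMap : Module.End ℝ V :=
  g.toMap (g.hodgeDual o S)

theorem form_hodgeMap (x y : V) : g.form (g.hodgeMap o S x) y = g.hodgeDual o S x y :=
  g.form_toMap _ x y

theorem hodgeMap_isSkewAdjoint : g.form.IsSkewAdjoint (g.hodgeMap o S) := fun x y => by
  rw [form_hodgeMap, Pi.neg_apply, map_neg, g.form_comm x, form_hodgeMap,
    (g.hodgeDual_isAlt o S).neg_eq]

theorem exists_hodgeMap_eq {J : Module.End ℝ V} (hJ : g.form.IsSkewAdjoint J) :
    ∃ S, g.hodgeMap o S = J := by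
  have halt : (g.form ∘ₗ J).IsAlt := fun x => by
    have h := hJ x x
    rw [Pi.neg_apply, map_neg, g.form_comm x] at h
    exact self_eq_neg.1 h
  obtain ⟨S, hS⟩ := g.exists_hodgeDual_eq o halt
  exact ⟨S, LinearMap.ext fun x => g.ext_form fun y => by rw [form_hodgeMap, hS]; rfl⟩

theorem apply_hodgeMap (x : V) : S (g.hodgeMap o S x) = 0 := by
  rw [← g.form_sharp, g.form_comm, form_hodgeMap, hodgeDual_apply_sharp]

theorem hodgeMap_sharp : g.hodgeMap o S (g.sharp S) = 0 :=
  g.ext_form fun x => by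
    rw [form_hodgeMap, ← (g.hodgeDual_isAlt o S).neg_eq, hodgeDual_apply_sharp, neg_zero,
      map_zero, LinearMap.zero_apply]

theorem form_hodgeMap_hodgeMap (x y : V) :
    g.form (g.hodgeMap o S x) (g.hodgeMap o S y) = g.coInner S S * g.form x y - S x * S y := by
  obtain ⟨e, he⟩ := g.exists_isOrthonormal
  have hδ := he.volumeForm_sq o
  have hvol := g.volumeForm_apply_eq_mul o e
  generalize g.volumeForm o e = δ at hδ hvol
  have hrepr (x : V) (i : Fin 3) : e.repr (g.hodgeMap o S x) i =
      (if i = 0 then 1 else -1) * g.volumeForm o ![x, e i, g.sharp S] := by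
    have h : g.form (e i) (g.hodgeMap o S x) = g.volumeForm o ![x, e i, g.sharp S] := by
      rw [g.form_comm, form_hodgeMap]; rfl
    rw [← h, he.form_basis_left]
    split_ifs <;> ring
  rw [← g.form_sharp S x, ← g.form_sharp S y, coInner]
  simp only [he.form_eq_sum, Fin.sum_univ_three, hrepr, hvol, e.repr_self, Finsupp.single_apply]
  simp only [↓reduceIte, Fin.isValue, zero_ne_one, zero_mul, Fin.reduceEq, sub_self, mul_zero,
    one_mul, sub_zero, zero_sub, one_ne_zero, mul_neg, neg_mul, neg_neg, sub_neg_eq_add, add_zero]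
  generalize e.repr x = x, e.repr y = y, e.repr (g.sharp S) = s
  linear_combination ((s 0 * s 0 - s 1 * s 1 - s 2 * s 2) * (x 0 * y 0 - x 1 * y 1 - x 2 * y 2) -
    (s 0 * x 0 - s 1 * x 1 - s 2 * x 2) * (s 0 * y 0 - s 1 * y 1 - s 2 * y 2)) * hδ

theorem hodgeMap_mul_self : g.hodgeMap o S * g.hodgeMap o S =
    S.smulRight (g.sharp S) - g.coInner S S • 1 := by
  refine LinearMap.ext fun x => g.ext_form fun y => ?_
  have h := g.hodgeMap_isSkewAdjoint o S (g.hodgeMap o S x) y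
  rw [Pi.neg_apply, map_neg, form_hodgeMap_hodgeMap] at h
  simp [h, form_sharp]

theorem hodgeMap_cube : g.hodgeMap o S * g.hodgeMap o S * g.hodgeMap o S =
    -g.coInner S S • g.hodgeMap o S := by
  ext x
  rw [hodgeMap_mul_self]
  simp [apply_hodgeMap]

theorem trace_hodgeMap : trace ℝ V (g.hodgeMap o S) = 0 := by
  have := g.finiteDimensional
  have h := trace_eq_trace_of_isAdjointPair (K := -g.hodgeMap o S) g.nondegenerate
    (g.hodgeMap_isSkewAdjoint o S)
  rw [map_neg] at h
  exact self_eq_neg.1 h.symm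

theorem trace_hodgeMap_mul_self :
    trace ℝ V (g.hodgeMap o S * g.hodgeMap o S) = -2 * g.coInner S S := by
  have := g.finiteDimensional
  rw [hodgeMap_mul_self, map_sub, map_smul, LinearMap.trace_smulRight, g.trace_one, apply_sharp,
    smul_eq_mul]
  push_cast
  ring

variable {S}

theorem eq_zero_of_hodgeMap_mul_self_eq_zero (h : g.hodgeMap o S * g.hodgeMap o S = 0) :
    S = 0 := by
  have hq : g.coInner S S = 0 := by
    have htr := g.trace_hodgeMap_mul_self o S
    rw [h, map_zero] at htr
    linarith
  by_contra hS
  obtain ⟨x, hx⟩ := DFunLike.ne_iff.1 hS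
  rw [hodgeMap_mul_self, hq, zero_smul, sub_zero] at h
  exact smul_ne_zero hx (g.sharp_ne_zero hS) (LinearMap.congr_fun h x)

theorem hodgeMap_eq_zero_iff : g.hodgeMap o S = 0 ↔ S = 0 := by
  refine ⟨fun h => g.eq_zero_of_hodgeMap_mul_self_eq_zero o (by rw [h, mul_zero]), ?_⟩
  rintro rfl
  refine LinearMap.ext fun x => g.ext_form fun y => ?_
  rw [form_hodgeMap, LinearMap.zero_apply, map_zero, LinearMap.zero_apply]
  exact (g.volumeForm o).map_coord_zero 2 (map_zero g.sharp)

end Hodge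

section Pencil

variable (α β γ : ℝ) (S : Module.Dual ℝ V)

theorem superenergy_apply (x y : V) :
    g.superenergy o S x y = S x * S y - g.coInner S S / 2 * g.form x y := by
  have h : g.superenergy o S x y =
      1 / 2 * (S x * S y + -g.form (g.hodgeMap o S x) (g.hodgeMap o S y)) := rfl
  rw [h, form_hodgeMap_hodgeMap]
  ring

/-- The tensor `β T{ω} + α g + γ *ω`; those of the theorem are the ones with `γ² = 2αβ ≠ 0`. -/
noncomputable def superenergyPencil : LinearMap.BilinForm ℝ V :=
  β • g.superenergy o S + α • g.form + γ • g.hodgeDual o S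

theorem smul_superenergyPencil (c : ℝ) : c • g.superenergyPencil o α β γ S =
    g.superenergyPencil o (c * α) (c * β) (c * γ) S := by
  simp only [superenergyPencil, smul_add, smul_smul]

theorem superenergyPencil_apply (x y : V) : g.superenergyPencil o α β γ S x y =
    β * (S x * S y - g.coInner S S / 2 * g.form x y) + α * g.form x y +
      γ * g.hodgeDual o S x y := by
  rw [← g.superenergy_apply o]
  rfl

theorem superenergyPencil_apply_self {x : V} (hx : g.form x x = 0) :
    g.superenergyPencil o α β γ S x x = β * S x ^ 2 := by
  rw [superenergyPencil_apply, hx, (g.hodgeDual_isAlt o S).self_eq_zero]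
  ring

theorem superenergyPencil_sub_swap (x y : V) :
    g.superenergyPencil o α β γ S x y - g.superenergyPencil o α β γ S y x =
      2 * γ * g.hodgeDual o S x y := by
  rw [superenergyPencil_apply, superenergyPencil_apply, g.form_comm y,
    ← (g.hodgeDual_isAlt o S).neg_eq x y]
  ring

theorem toMap_superenergyPencil : g.toMap (g.superenergyPencil o α β γ S) =
    ((2 * α + β * g.coInner S S) / 2) • 1 + γ • g.hodgeMap o S +
      β • (g.hodgeMap o S * g.hodgeMap o S) := by
  refine LinearMap.ext fun x => g.ext_form fun y => ?_
  rw [form_toMap, superenergyPencil_apply, hodgeMap_mul_self]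
  simp only [LinearMap.add_apply, LinearMap.smul_apply, Module.End.one_apply,
    LinearMap.sub_apply, LinearMap.coe_smulRight, map_add, map_smul, map_sub, smul_eq_mul,
    form_hodgeMap, form_sharp]
  ring

theorem toMap_superenergyPencil_sharp : g.toMap (g.superenergyPencil o α β γ S) (g.sharp S) =
    ((2 * α + β * g.coInner S S) / 2) • g.sharp S := by
  simp [toMap_superenergyPencil, hodgeMap_sharp]

variable {α β γ}

theorem form_toMap_superenergyPencil (hγ : γ ^ 2 = 2 * α * β) (x y : V) :
    g.form (g.toMap (g.superenergyPencil o α β γ S) x)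
        (g.toMap (g.superenergyPencil o α β γ S) y) =
      ((2 * α + β * g.coInner S S) / 2) ^ 2 * g.form x y := by
  have hskew : g.form x (g.hodgeMap o S y) = -g.form (g.hodgeMap o S x) y := by
    rw [g.hodgeMap_isSkewAdjoint o S x y, Pi.neg_apply, map_neg, neg_neg]
  have hsharp (z : V) : g.form z (g.sharp S) = S z := by rw [g.form_comm, form_sharp]
  rw [toMap_superenergyPencil, hodgeMap_mul_self]
  simp only [LinearMap.add_apply, LinearMap.smul_apply, Module.End.one_apply,
    LinearMap.sub_apply, LinearMap.coe_smulRight, map_add, map_smul, map_sub, smul_eq_mul, hskew,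
    mul_neg, hsharp, form_hodgeMap_hodgeMap, apply_hodgeMap, mul_zero, zero_sub, form_sharp,
    add_zero, apply_sharp]
  linear_combination (g.coInner S S * g.form x y - S x * S y) * hγ

theorem isLorentz_inv_smul_toMap_superenergyPencil (hγ : γ ^ 2 = 2 * α * β)
    (hA : 2 * α + β * g.coInner S S ≠ 0) :
    g.IsLorentz (((2 * α + β * g.coInner S S) / 2)⁻¹ •
      g.toMap (g.superenergyPencil o α β γ S)) := fun x y => by
  simp only [LinearMap.smul_apply, map_smul, g.form_toMap_superenergyPencil o S hγ, smul_eq_mul]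
  field_simp

variable {S}

theorem det_toMap_superenergyPencil_ne_zero_iff (hγ : γ ^ 2 = 2 * α * β) (hS : S ≠ 0) :
    det (g.toMap (g.superenergyPencil o α β γ S)) ≠ 0 ↔ 2 * α + β * g.coInner S S ≠ 0 := by
  have := g.finiteDimensional
  rw [← isUnit_iff_ne_zero, ← LinearMap.isUnit_iff_isUnit_det]
  constructor
  · intro hunit hA
    have hker := g.toMap_superenergyPencil_sharp o α β γ S
    rw [hA, zero_div, zero_smul] at hker
    exact g.sharp_ne_zero hS (LinearMap.ker_eq_bot'.1
      ((LinearMap.isUnit_iff_ker_eq_bot _).1 hunit) _ hker)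
  · intro hA
    exact (isUnit_smul_iff (Units.mk0 _ (inv_ne_zero (div_ne_zero hA two_ne_zero))) _).1
      (g.isLorentz_inv_smul_toMap_superenergyPencil o S hγ hA).isUnit

theorem isPropNonInvolutoryLorentz_superenergyPencil (hγ₀ : γ ≠ 0) (hγ : γ ^ 2 = 2 * α * β)
    (hS : S ≠ 0) (hA : 2 * α + β * g.coInner S S ≠ 0) :
    g.IsPropNonInvolutoryLorentz (g.superenergyPencil o α β γ S) := by
  have hA' : (2 * α + β * g.coInner S S) / 2 ≠ 0 := div_ne_zero hA two_ne_zero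
  have hL := g.isLorentz_inv_smul_toMap_superenergyPencil o S hγ hA
  refine ⟨_, _, hA', hL, fun hLL => hS ?_, (smul_inv_smul₀ hA' _).symm⟩
  have hadj := hL.isAdjointPair hLL
  have hself : IsAdjointPair g.form g.form (g.toMap (g.superenergyPencil o α β γ S))
      (g.toMap (g.superenergyPencil o α β γ S)) := fun x y =>
    mul_left_cancel₀ (inv_ne_zero hA') <| by
      simpa only [map_smul, LinearMap.smul_apply, smul_eq_mul] using hadj x y
  refine (g.hodgeMap_eq_zero_iff o).1 (LinearMap.ext fun x => g.ext_form fun y => ?_)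
  have hswap := g.superenergyPencil_sub_swap o α β γ S x y
  rw [← g.form_toMap _ x y, hself x y, g.form_comm, form_toMap, sub_self] at hswap
  rw [form_hodgeMap]
  simpa [hγ₀] using hswap.symm

end Pencil

section Converse

variable {g} {L K : Module.End ℝ V}

theorem IsLorentz.mul_self_eq (hL : g.IsLorentz L) (hLK : L * K = 1) (hdet : det L = 1) :
    L * L = trace ℝ V L • (L - 1) + K := by
  obtain ⟨e, -⟩ := g.exists_basis
  have h := mul_self_sub_trace_smul_add_of_mul_eq_one e hLK
  rw [hL.trace_eq_of_mul_eq_one hLK, hdet, one_mul, one_smul] at h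
  rw [← h]
  module

theorem IsLorentz.isSkewAdjoint_half_sub (hL : g.IsLorentz L) (hLK : L * K = 1) :
    g.form.IsSkewAdjoint ((1 / 2 : ℝ) • (L - K) : Module.End ℝ V) := fun x y => by
  have hyx := hL.isAdjointPair hLK y x
  rw [g.form_comm, g.form_comm y] at hyx
  simp only [LinearMap.smul_apply, LinearMap.sub_apply, map_smul, map_sub,
    hL.isAdjointPair hLK x y, smul_eq_mul, LinearMap.coe_smul, Pi.neg_apply, Pi.smul_apply,
    map_neg, hyx]
  ring

theorem IsLorentz.half_sub_mul_self (hL : g.IsLorentz L) (hLK : L * K = 1) (hdet : det L = 1) :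
    ((1 / 2 : ℝ) • (L - K)) * ((1 / 2 : ℝ) • (L - K)) =
      ((trace ℝ V L + 1) / 4) • (L + K - (2 : ℝ) • 1) := by
  have := g.finiteDimensional
  have hKL : K * L = 1 := mul_eq_one_comm.1 hLK
  have hdetK : det K = 1 := by rw [← one_mul (det K), ← hdet, ← map_mul, hLK, map_one, hdet]
  have hKK := (hL.of_mul_eq_one hLK).mul_self_eq hKL hdetK
  rw [hL.trace_eq_of_mul_eq_one hLK] at hKK
  rw [smul_mul_smul_comm, mul_sub, sub_mul, sub_mul, hL.mul_self_eq hLK hdet, hKK, hLK, hKL]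
  module

theorem IsLorentz.exists_eq_toMap_superenergyPencil (hL : g.IsLorentz L) (hdet : det L = 1)
    (hLL : L * L ≠ 1) :
    ∃ (α β : ℝ) (S : Module.Dual ℝ V), 2 * α * β = 1 ∧ S ≠ 0 ∧ 2 * α + β * g.coInner S S = 2 ∧
      L = g.toMap (g.superenergyPencil o α β 1 S) := by
  have := g.finiteDimensional
  obtain ⟨K, hLK⟩ := hL.isUnit.exists_right_inv
  obtain ⟨S, hS⟩ := g.exists_hodgeMap_eq o (hL.isSkewAdjoint_half_sub hLK)
  have hJJ : g.hodgeMap o S * g.hodgeMap o S =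
      ((trace ℝ V L + 1) / 4) • (L + K - (2 : ℝ) • 1) := by
    rw [hS, hL.half_sub_mul_self hLK hdet]
  have hS₀ : S ≠ 0 := fun h => hLL <| by
    rw [(g.hodgeMap_eq_zero_iff o).2 h, eq_comm, smul_eq_zero_iff_right (by norm_num)] at hS
    rw [sub_eq_zero.1 hS, ← hLK, sub_eq_zero.1 hS]
  have ht : trace ℝ V L + 1 ≠ 0 := fun ht =>
    hS₀ (g.eq_zero_of_hodgeMap_mul_self_eq_zero o (by rw [hJJ, ht, zero_div, zero_smul]))
  have hq : g.coInner S S = (trace ℝ V L + 1) * (3 - trace ℝ V L) / 4 := by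
    have htr := g.trace_hodgeMap_mul_self o S
    rw [hJJ, map_smul, map_sub, map_add, map_smul, g.trace_one,
      hL.trace_eq_of_mul_eq_one hLK] at htr
    push_cast [smul_eq_mul] at htr
    linarith
  have hA : 2 * ((trace ℝ V L + 1) / 4) + 2 / (trace ℝ V L + 1) * g.coInner S S = 2 := by
    rw [hq]
    field_simp
    ring
  refine ⟨(trace ℝ V L + 1) / 4, 2 / (trace ℝ V L + 1), S, by field_simp; norm_num, hS₀, hA, ?_⟩
  rw [toMap_superenergyPencil, hA, hJJ, hS, one_smul, smul_smul,
    show 2 / (trace ℝ V L + 1) * ((trace ℝ V L + 1) / 4) = 1 / 2 by field_simp; norm_num]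
  module

variable (g)

theorem isPropNonInvolutoryLorentz_iff_exists_superenergyPencil {T : LinearMap.BilinForm ℝ V} :
    g.IsPropNonInvolutoryLorentz T ↔
      ∃ (α β γ : ℝ) (S : Module.Dual ℝ V), γ ≠ 0 ∧ γ ^ 2 = 2 * α * β ∧ S ≠ 0 ∧
        2 * α + β * g.coInner S S ≠ 0 ∧ T = g.superenergyPencil o α β γ S := by
  constructor
  · intro hT
    obtain ⟨c, L, hc, hL, hLL, hdet, hTL⟩ := hT.exists_det_eq_one (by decide)
    obtain ⟨α, β, S, hαβ, hS, hA, hLS⟩ := hL.exists_eq_toMap_superenergyPencil o hdet hLL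
    refine ⟨c * α, c * β, c * 1, S, by rwa [mul_one], ?_, hS, ?_, ?_⟩
    · linear_combination -c ^ 2 * hαβ
    · rw [show 2 * (c * α) + c * β * g.coInner S S = c * 2 by
        linear_combination c * hA]
      exact mul_ne_zero hc two_ne_zero
    · rw [← smul_superenergyPencil]
      exact g.toMap_injective (by rw [hTL, hLS, toMap_smul])
  · rintro ⟨α, β, γ, S, hγ₀, hγ, hS, hA, rfl⟩
    exact g.isPropNonInvolutoryLorentz_superenergyPencil o hγ₀ hγ hS hA

end Converse

section InvariantNullDirections

variable {g} {S : Module.Dual ℝ V} {k w : V}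

theorem exists_hodgeMap_apply_eq_smul (hk : k ≠ 0) (hkk : g.form k k = 0) (hSk : S k = 0) :
    ∃ m : ℝ, g.hodgeMap o S k = m • k ∧ m ^ 2 = -g.coInner S S := by
  have horth : g.form k (g.hodgeMap o S k) = 0 := by
    rw [g.form_comm, form_hodgeMap, (g.hodgeDual_isAlt o S).self_eq_zero]
  have hnull : g.form (g.hodgeMap o S k) (g.hodgeMap o S k) = 0 := by
    rw [form_hodgeMap_hodgeMap, hkk, hSk, mul_zero, mul_zero, sub_zero]
  obtain ⟨m, hm⟩ := Submodule.mem_span_singleton.1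
    (mem_span_singleton_of_orthogonal_null hk hkk horth hnull.ge)
  refine ⟨m, hm.symm, smul_left_injective ℝ hk ?_⟩
  have hJJ := LinearMap.congr_fun (g.hodgeMap_mul_self o S) k
  rw [Module.End.mul_apply, ← hm, map_smul, ← hm, smul_smul, ← sq] at hJJ
  simpa [hSk] using hJJ

variable {o} {r : ℝ} (hr : r ≠ 0)

include hr

theorem exists_hodgeMap_apply_eq_smul_of_coInner_eq (hq : g.coInner S S = -r ^ 2) :
    ∃ k ≠ 0, g.hodgeMap o S k = r • k := by
  have hJ : g.hodgeMap o S * g.hodgeMap o S + r • g.hodgeMap o S ≠ 0 := fun h => by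
    have htr := congrArg (trace ℝ V) h
    rw [map_add, map_smul, trace_hodgeMap_mul_self, trace_hodgeMap, hq, map_zero, smul_zero] at htr
    exact pow_ne_zero 2 hr (by linarith)
  obtain ⟨y, hy⟩ := DFunLike.ne_iff.1 hJ
  refine ⟨_, hy, ?_⟩
  have hcube := LinearMap.congr_fun (g.hodgeMap_cube o S) y
  simp only [Module.End.mul_apply, LinearMap.smul_apply, hq, neg_neg] at hcube
  simp only [Module.End.mul_apply, LinearMap.add_apply, LinearMap.smul_apply, map_add, map_smul,
    hcube]
  module

theorem apply_eq_zero_of_hodgeMap_apply_eq_smul (hk : g.hodgeMap o S k = r • k) : S k = 0 := by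
  have h := g.apply_hodgeMap o S k
  rw [hk, map_smul, smul_eq_mul] at h
  exact (mul_eq_zero.1 h).resolve_left hr

theorem form_eq_zero_of_hodgeMap_apply_eq_smul (hk : g.hodgeMap o S k = r • k)
    (hw : g.hodgeMap o S w = r • w) : g.form k w = 0 := by
  have h := g.hodgeMap_isSkewAdjoint o S k w
  rw [Pi.neg_apply, hk, hw, map_neg, map_smul, map_smul, LinearMap.smul_apply, smul_eq_mul] at h
  exact (mul_eq_zero.1 (self_eq_neg.1 h)).resolve_left hr

theorem span_singleton_eq_of_hodgeMap_apply_eq_smul (hk₀ : k ≠ 0) (hw₀ : w ≠ 0)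
    (hk : g.hodgeMap o S k = r • k) (hw : g.hodgeMap o S w = r • w) :
    Submodule.span ℝ {w} = Submodule.span ℝ {k} :=
  span_singleton_eq_of_orthogonal_null hk₀ hw₀
    (form_eq_zero_of_hodgeMap_apply_eq_smul hr hk hk)
    (form_eq_zero_of_hodgeMap_apply_eq_smul hr hw hw)
    (form_eq_zero_of_hodgeMap_apply_eq_smul hr hk hw)

theorem span_singleton_mem_nullDirections_ker (hk₀ : k ≠ 0) (hk : g.hodgeMap o S k = r • k) :
    Submodule.span ℝ {k} ∈ g.nullDirections (LinearMap.ker S) :=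
  ⟨k, apply_eq_zero_of_hodgeMap_apply_eq_smul hr hk, hk₀,
    form_eq_zero_of_hodgeMap_apply_eq_smul hr hk hk, rfl⟩

theorem span_singleton_ne_of_hodgeMap_apply_eq_smul_neg (hw₀ : w ≠ 0)
    (hk : g.hodgeMap o S k = r • k) (hw : g.hodgeMap o S w = -r • w) :
    Submodule.span ℝ {k} ≠ Submodule.span ℝ {w} := fun h => by
  obtain ⟨m, rfl⟩ := Submodule.mem_span_singleton.1
    (h ▸ Submodule.mem_span_singleton_self w : w ∈ Submodule.span ℝ {k})
  rw [map_smul, hk, smul_comm] at hw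
  exact hr (self_eq_neg.1 (smul_left_injective ℝ hw₀ hw))

omit hr

theorem encard_nullDirections_ker_eq_two (hq : g.coInner S S < 0) :
    (g.nullDirections (LinearMap.ker S)).encard = 2 := by
  obtain ⟨r, hr, hqr⟩ : ∃ r : ℝ, r ≠ 0 ∧ g.coInner S S = -r ^ 2 :=
    ⟨√(-g.coInner S S), (Real.sqrt_pos.2 (neg_pos.2 hq)).ne', by
      rw [Real.sq_sqrt (neg_pos.2 hq).le, neg_neg]⟩
  have hr' : -r ≠ 0 := neg_ne_zero.2 hr
  obtain ⟨e, -⟩ := g.exists_basis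
  obtain ⟨k, hk₀, hk⟩ := exists_hodgeMap_apply_eq_smul_of_coInner_eq (o := e.orientation) hr hqr
  obtain ⟨n, hn₀, hn⟩ :=
    exists_hodgeMap_apply_eq_smul_of_coInner_eq (o := e.orientation) hr' (by rwa [neg_sq])
  refine Set.encard_eq_two.2 ⟨Submodule.span ℝ {k}, Submodule.span ℝ {n},
    span_singleton_ne_of_hodgeMap_apply_eq_smul_neg hr hn₀ hk hn, Set.Subset.antisymm ?_ ?_⟩
  · rintro - ⟨w, hSw, hw₀, hww, rfl⟩
    obtain ⟨m, hw, hm⟩ := exists_hodgeMap_apply_eq_smul e.orientation hw₀ hww hSw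
    rw [hqr, neg_neg, sq_eq_sq_iff_eq_or_eq_neg] at hm
    rcases hm with rfl | rfl
    · exact Or.inl (span_singleton_eq_of_hodgeMap_apply_eq_smul hr hk₀ hw₀ hk hw)
    · exact Or.inr (span_singleton_eq_of_hodgeMap_apply_eq_smul hr' hn₀ hw₀ hn hw)
  · rintro - (rfl | rfl)
    · exact span_singleton_mem_nullDirections_ker hr hk₀ hk
    · exact span_singleton_mem_nullDirections_ker hr' hn₀ hn

variable (g o)

theorem invariantNullDirections_superenergyPencil {α β γ : ℝ} (hβ : β ≠ 0)
    (hγ : γ ^ 2 = 2 * α * β) (hdet : det (g.toMap (g.superenergyPencil o α β γ S)) ≠ 0) :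
    g.invariantNullDirections (g.toMap (g.superenergyPencil o α β γ S)) =
      g.nullDirections (LinearMap.ker S) := by
  have := g.finiteDimensional
  refine invariantNullDirections_eq_nullDirections ?_ (fun x hx => ?_) fun x hx => ?_
  · rw [← LinearMap.ker_eq_bot, ← LinearMap.isUnit_iff_ker_eq_bot,
      LinearMap.isUnit_iff_isUnit_det]
    exact hdet.isUnit
  · rw [g.form_toMap_superenergyPencil o S hγ, hx, mul_zero]
  · rw [g.form_comm, form_toMap, superenergyPencil_apply_self _ _ _ _ _ _ hx,
      mul_eq_zero_iff_left hβ, sq_eq_zero_iff, LinearMap.mem_ker]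

end InvariantNullDirections

end Three

end LorentzMetric

theorem mainTheorem12 {V : Type*} [AddCommGroup V] [Module ℝ V]
    (g : LorentzMetric 3 V) (o : Orientation ℝ V (Fin 3)) :
    -- the maps proportional to non-involutory Lorentz transformations
    (∀ T : LinearMap.BilinForm ℝ V,
      g.IsPropNonInvolutoryLorentz T ↔
        ∃ (α β ε : ℝ) (S : Module.Dual ℝ V),
          0 < α * β ∧ (ε = 1 ∨ ε = -1) ∧ S ≠ 0 ∧ 2 * α + β * g.coInner S S ≠ 0 ∧
          T = β • g.superenergy o S + α • g.form + (ε * √(2 * α * β)) • g.hodgeDual o S) ∧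
    -- the excluded case is that of the singular tensors, and the invariant null directions
    (∀ (α β ε : ℝ) (S : Module.Dual ℝ V) (T : LinearMap.BilinForm ℝ V),
      0 < α * β → (ε = 1 ∨ ε = -1) → S ≠ 0 →
      T = β • g.superenergy o S + α • g.form + (ε * √(2 * α * β)) • g.hodgeDual o S →
        (LinearMap.det (g.toMap T) ≠ 0 ↔ 2 * α + β * g.coInner S S ≠ 0) ∧
        (LinearMap.det (g.toMap T) ≠ 0 →
          (0 < g.coInner S S → (g.invariantNullDirections (g.toMap T)).encard = 0) ∧
          (g.coInner S S = 0 → (g.invariantNullDirections (g.toMap T)).encard = 1) ∧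
          (g.coInner S S < 0 → (g.invariantNullDirections (g.toMap T)).encard = 2))) := by
  have hsqrt {α β γ : ℝ} : (γ ≠ 0 ∧ γ ^ 2 = 2 * α * β) ↔
      0 < α * β ∧ ∃ ε : ℝ, (ε = 1 ∨ ε = -1) ∧ γ = ε * √(2 * α * β) := by
    rw [ne_zero_and_sq_eq_iff_exists_sign_mul_sqrt, mul_assoc, mul_pos_iff_of_pos_left two_pos]
  refine ⟨fun T => (g.isPropNonInvolutoryLorentz_iff_exists_superenergyPencil o).trans ?_, ?_⟩
  · constructor
    · rintro ⟨α, β, γ, S, hγ₀, hγ, hS, hA, rfl⟩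
      obtain ⟨hαβ, ε, hε, rfl⟩ := hsqrt.1 ⟨hγ₀, hγ⟩
      exact ⟨α, β, ε, S, hαβ, hε, hS, hA, rfl⟩
    · rintro ⟨α, β, ε, S, hαβ, hε, hS, hA, rfl⟩
      obtain ⟨hγ₀, hγ⟩ := hsqrt.2 ⟨hαβ, ε, hε, rfl⟩
      exact ⟨α, β, _, S, hγ₀, hγ, hS, hA, rfl⟩
  · rintro α β ε S T hαβ hε hS (rfl : T = g.superenergyPencil o α β _ S)
    obtain ⟨-, hγ⟩ := hsqrt.2 ⟨hαβ, ε, hε, rfl⟩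
    refine ⟨g.det_toMap_superenergyPencil_ne_zero_iff o hγ hS, fun hdet => ?_⟩
    rw [g.invariantNullDirections_superenergyPencil o (right_ne_zero_of_mul hαβ.ne') hγ hdet]
    exact ⟨fun hq => by rw [LorentzMetric.nullDirections_ker_eq_empty hq, Set.encard_empty],
      fun hq => by
        rw [LorentzMetric.nullDirections_ker_eq_singleton hS hq, Set.encard_singleton],
      LorentzMetric.encard_nullDirections_ker_eq_two⟩
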